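/- Let $S$ be a set of unit squares of the lattice $\mathbb Z^2$, and let $G$ be the cell complex formed by these squares, their sides and their corners $v_{m,n}$, $(m,n)\in\mathbb Z^2$; assume that $G$ is simply connected (in particular nonempty and connected). A ring at a vertex $v_i$ of $G$ is a pair of concentric circles $c_i$, $C_i$ in $\mathbb R^2=\mathbb C$ with radii $|r_i|$ and $R_i>0$, where $r_i\in\mathbb R$ is signed ($r_i>0$: counter-clockwise, $r_i<0$: clockwise orientation, $r_i=0$: $c_i$ is a point); its area is $(R_i^2-r_i^2)\pi$. An orthogonal ring pattern on $G$ assigns a ring to every vertex of $G$ such that 1. for all neighbouring vertices $v_i,v_j$ (i.e. joined by a side of a square of $S$), $C_i$ intersects $c_j$ orthogonally and $c_i$ intersects $C_j$ orthogonally; 2. in each square of $S$ with lower left corner $v_{m,n}$, the inner circles $c_{m,n},c_{m+1,n+1}$ and the outer circles $C_{m+1,n},C_{m,n+1}$ pass through one point $q$; 3. for each such square, with $v_i$ either of the two corners $v_{m,n}$, $v_{m+1,n+1}$, and $v_j,v_k$ the corners that follow and precede $v_i$ in the counter-clockwise order around the square, the triangles (center of $v_i$, center of $v_j$, $q$) and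 (center of $v_i$, $q$, center of $v_k$) are counter-clockwise if $r_i>0$, clockwise if $r_i<0$ and degenerate if $r_i=0$; and the outer circles $C_{m+1,n},C_{m,n+1}$ touch externally at $q$ (this follows from the preceding conditions unless $r_{m,n}=r_{m+1,n+1}=0$). Let $\mathcal R$ be an orthogonal ring pattern on $G$ all of whose rings have area $\pi$, with $\rho$-radii $\rho_i\in\mathbb R$, that is, $r_i=\sinh\rho_i$ and $R_i=\cosh\rho_i$ for every vertex $v_i$ of $G$. Then the shifted $\rho$-radii $\rho_i^\delta=\rho_i+\delta$ define a one-parameter family of orthogonal ring patterns: there are orthogonal ring patterns $\mathcal R^\delta$ on $G$, $\delta\in\mathbb R$, with $\mathcal R^0=\mathcal R$ and with centers depending continuously on $\delta$, such that for all $\delta\in\mathbb R$ and all vertices $v_i$ of $G$ $$ r_i^\delta=\sinh(\rho_i+\delta),\qquad R_i^\delta=\cosh(\rho_i+\delta), $$ and every ring of $\mathcal R^\delta$ has area $\pi$. Moreover, if any two squares of $S$ can be joined by a chain of squares of $S$ in which consecutive squares share a side, then for every $\delta\in\mathbb R$ the orthogonal ring pattern on $G$ with $\rho$-radii $\rho_i+\delta$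 is unique up to an orientation-preserving isometry of the plane. -/

import Mathlib

namespace RingPattern

/-! ### Subcomplexes of the square lattice

A square of the lattice `ℤ²` is named by its lower left corner. A set `S` of squares determines the
subcomplex consisting of these squares, their sides and their corners. -/

/-- The lower right corner of the square `s`. -/
def se (s : ℤ × ℤ) : ℤ × ℤ := (s.1 + 1, s.2)

/-- The upper left corner of the square `s`. -/
def nw (s : ℤ × ℤ) : ℤ × ℤ := (s.1, s.2 + 1)

/-- The upper right corner of the square `s`. -/
def ne (s : ℤ × ℤ) : ℤ × ℤ := (s.1 + 1, s.2 + 1)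

/-- The vertices of the subcomplex: the corners of its squares. -/
def vertices (S : Set (ℤ × ℤ)) : Set (ℤ × ℤ) :=
  {v | ∃ s ∈ S, v = s ∨ v = se s ∨ v = ne s ∨ v = nw s}

/-- `v` and `w` are the first and the second endpoint of a (horizontal or vertical) oriented edge of
the subcomplex, i.e. of a side of one of its squares. -/
def IsEdge (S : Set (ℤ × ℤ)) (v w : ℤ × ℤ) : Prop :=
  ∃ s ∈ S, (v = s ∧ w = se s) ∨ (v = nw s ∧ w = ne s) ∨ (v = s ∧ w = nw s) ∨ (v = se s ∧ w = ne s)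

/-- The `1`-skeleton of the subcomplex. -/
def skeleton (S : Set (ℤ × ℤ)) : SimpleGraph (ℤ × ℤ) := SimpleGraph.fromRel (IsEdge S)

/-- Homotopy of edge paths (with fixed endpoints) in the subcomplex: the smallest congruence with
respect to concatenation for which an edge followed by its reverse is trivial and for which a path
may be pushed across a square of the subcomplex. -/
inductive EdgeHomotopic (S : Set (ℤ × ℤ)) :
    ∀ {v w : ℤ × ℤ}, (skeleton S).Walk v w → (skeleton S).Walk v w → Prop
  | refl {v w : ℤ × ℤ} (p : (skeleton S).Walk v w) : EdgeHomotopic S p p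
  | symm {v w : ℤ × ℤ} {p q : (skeleton S).Walk v w} :
      EdgeHomotopic S p q → EdgeHomotopic S q p
  | trans {v w : ℤ × ℤ} {p q k : (skeleton S).Walk v w} :
      EdgeHomotopic S p q → EdgeHomotopic S q k → EdgeHomotopic S p k
  | append {v w x : ℤ × ℤ} {p p' : (skeleton S).Walk v w} {q q' : (skeleton S).Walk w x} :
      EdgeHomotopic S p p' → EdgeHomotopic S q q' →
        EdgeHomotopic S (p.append q) (p'.append q')
  | backtrack {v w : ℤ × ℤ} (h : (skeleton S).Adj v w) (h' : (skeleton S).Adj w v) :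
      EdgeHomotopic S (.cons h (.cons h' .nil)) .nil
  | square {s : ℤ × ℤ} (hs : s ∈ S)
      (h₁ : (skeleton S).Adj s (se s)) (h₂ : (skeleton S).Adj (se s) (ne s))
      (h₃ : (skeleton S).Adj s (nw s)) (h₄ : (skeleton S).Adj (nw s) (ne s)) :
      EdgeHomotopic S (.cons h₁ (.cons h₂ .nil)) (.cons h₃ (.cons h₄ .nil))

/-- The subcomplex is simply connected: nonempty, connected, and with trivial edge path group. -/
structure SimplyConnectedComplex (S : Set (ℤ × ℤ)) : Prop where
  nonempty : S.Nonempty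
  connected : ∀ v ∈ vertices S, ∀ w ∈ vertices S, (skeleton S).Reachable v w
  loops : ∀ (v : ℤ × ℤ) (p : (skeleton S).Walk v v), EdgeHomotopic S p .nil

/-- Any two squares of the subcomplex are joined by a chain of squares of the subcomplex in which
consecutive squares have a common side. -/
def SideConnected (S : Set (ℤ × ℤ)) : Prop :=
  ∀ s ∈ S, ∀ t ∈ S, Relation.ReflTransGen
    (fun a b : ℤ × ℤ => b ∈ S ∧ (a.1 - b.1).natAbs + (a.2 - b.2).natAbs = 1) s t

/-! ### Rings and orthogonal ring patterns -/

/-- An assignment of a ring to each vertex: its center, the signed radius `r` of the inner circle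
(negative for the clockwise orientation), and the radius `R` of the outer circle. Only the values
at the vertices of the subcomplex under consideration matter. -/
structure Rings where
  /-- the common center of the two circles -/
  center : ℤ × ℤ → ℂ
  /-- the signed inner radius -/
  r : ℤ × ℤ → ℝ
  /-- the outer radius -/
  R : ℤ × ℤ → ℝ

namespace Rings

variable (P : Rings)

/-- The inner circle (a point if `r = 0`). -/
def inner (v : ℤ × ℤ) : Set ℂ := Metric.sphere (P.center v) |P.r v|

/-- The outer circle. -/
def outer (v : ℤ × ℤ) : Set ℂ := Metric.sphere (P.center v) (P.R v)

/-- The area of the ring at `v`. -/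
noncomputable def area (v : ℤ × ℤ) : ℝ := ((P.R v) ^ 2 - (P.r v) ^ 2) * Real.pi

/-- The circles of the rings `v` and `w` given by the sets `K` and `L` intersect orthogonally: they
have a common point at which their radius vectors (equivalently, their tangents) are perpendicular.
(By reflection in the line of centers the same then holds at every common point.) -/
def CirclesOrthogonal (v w : ℤ × ℤ) (K L : Set ℂ) : Prop :=
  ∃ p ∈ K ∩ L, Inner.inner ℝ (p - P.center v) (p - P.center w) = 0

/-- The rings at `v` and `w` intersect orthogonally: the outer circle of each of them intersects the
inner circle of the other one orthogonally. -/
def RingsOrthogonal (v w : ℤ × ℤ) : Prop :=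
  P.CirclesOrthogonal v w (P.outer v) (P.inner w) ∧
    P.CirclesOrthogonal v w (P.inner v) (P.outer w)

end Rings

/-- Twice the signed area of the triangle `a b c`: positive if `a, b, c` are in counter-clockwise
order, negative if they are in clockwise order. -/
def orient (a b c : ℂ) : ℝ :=
  (b - a).re * (c - a).im - (b - a).im * (c - a).re

/-- The rings at the four corners of the square `s` fit together at the point `q`.

The first four fields say that the two inner circles of one diagonal and the two outer circles of
the other diagonal pass through `q`. The other fields are the orientation condition. As seen from
the center of an inner circle through `q`, the points: center of the next outer circle, `q`, center
of the other outer circle, follow each other in the direction in which that inner circle is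
oriented (counter-clockwise if `r > 0`, clockwise if `r < 0`), and the two outer circles, which are
both positively oriented, touch externally. If `r ≠ 0` for one of the two inner circles, the latter
follows from orthogonality and the other orientation conditions; if both inner circles shrink to
the point `q`, it is what remains of these conditions in the limit `r → 0`. -/
structure FitsAt (P : Rings) (s : ℤ × ℤ) (q : ℂ) : Prop where
  mem_inner_sw : q ∈ P.inner s
  mem_inner_ne : q ∈ P.inner (ne s)
  mem_outer_se : q ∈ P.outer (se s)
  mem_outer_nw : q ∈ P.outer (nw s)
  orient_sw_se : SignType.sign (orient (P.center s) (P.center (se s)) q) = SignType.sign (P.r s)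
  orient_sw_nw : SignType.sign (orient (P.center s) q (P.center (nw s))) = SignType.sign (P.r s)
  orient_ne_nw : SignType.sign (orient (P.center (ne s)) (P.center (nw s)) q) =
    SignType.sign (P.r (ne s))
  orient_ne_se : SignType.sign (orient (P.center (ne s)) q (P.center (se s))) =
    SignType.sign (P.r (ne s))
  outer_touch : dist (P.center (se s)) (P.center (nw s)) = P.R (se s) + P.R (nw s)

/-- Orthogonal ring patterns on the subcomplex given by the set `S` of squares. -/
structure IsOrthogonalRingPattern (S : Set (ℤ × ℤ)) (P : Rings) : Prop where
  outer_pos : ∀ v ∈ vertices S, 0 < P.R v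
  orthogonal : ∀ v w, (skeleton S).Adj v w → P.RingsOrthogonal v w
  fits : ∀ s ∈ S, ∃ q : ℂ, FitsAt P s q

/-- `ρ` are `ρ`-radii of the rings `P`, of constant area `π ℓ ^ 2`. -/
def HasRhoRadii (S : Set (ℤ × ℤ)) (P : Rings) (ℓ : ℝ) (ρ : ℤ × ℤ → ℝ) : Prop :=
  ∀ v ∈ vertices S, P.r v = ℓ * Real.sinh (ρ v) ∧ P.R v = ℓ * Real.cosh (ρ v)

end RingPattern

open RingPattern

/-!
In one square, an orthogonal ring pattern amounts to four centers on two perpendicular lines through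
the point `q`: those of the outer circles at distance `R` from `q` on one line, in the direction of
a unit vector `u`, those of the inner circles at signed distance `r` on the other. So the edge
vectors are `u (± R + i r)`, with `R` and `r` taken at the two endpoints. For `R = ℓ cosh a` and
`r = ℓ sinh b` there is the factorization `cosh a + i sinh b = E x * conj (E y)` with
`E t = cosh t + i sinh t`, `x = (a + b) / 2` and `y = (a - b) / 2`. Hence shifting all `ρ`-radii by
`δ`, without changing `u`, multiplies the edge vector by `E (x + δ) / E x` if the edge is horizontal
and by the conjugate of this number if it is vertical. The factor only depends on the edge, not on
which of the adjacent squares is considered, so the new edge vectors form a `1`-form on the whole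
complex. This form is closed, and it integrates to the new centers because loops are contractible.

Up to an isometry a square is determined by its radii, since only `u` and `q` are free, and adjacent
squares share two distinct centers; so the pattern is determined along chains of squares.
-/

namespace RingPattern

open Complex ComplexConjugate

section Lattice

variable {S : Set (ℤ × ℤ)} {s t v w : ℤ × ℤ}

/-- `v` is one of the four corners of the square `s`. -/
def IsCorner (s v : ℤ × ℤ) : Prop := v = s ∨ v = se s ∨ v = ne s ∨ v = nw s

theorem self_mem_vertices (hs : s ∈ S) : s ∈ vertices S := ⟨s, hs, .inl rfl⟩

theorem se_mem_vertices (hs : s ∈ S) : se s ∈ vertices S := ⟨s, hs, .inr (.inl rfl)⟩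

theorem ne_mem_vertices (hs : s ∈ S) : ne s ∈ vertices S := ⟨s, hs, .inr (.inr (.inl rfl))⟩

theorem nw_mem_vertices (hs : s ∈ S) : nw s ∈ vertices S := ⟨s, hs, .inr (.inr (.inr rfl))⟩

theorem skeleton_adj_of_isEdge (h : IsEdge S v w) : (skeleton S).Adj v w := by
  refine (SimpleGraph.fromRel_adj _ _ _).2 ⟨?_, .inl h⟩
  obtain ⟨s, -, h⟩ := h
  rintro rfl
  simp only [se, nw, ne, Prod.ext_iff] at h
  omega

theorem skeleton_adj_bottom (hs : s ∈ S) : (skeleton S).Adj s (se s) :=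
  skeleton_adj_of_isEdge ⟨s, hs, .inl ⟨rfl, rfl⟩⟩

theorem skeleton_adj_top (hs : s ∈ S) : (skeleton S).Adj (nw s) (ne s) :=
  skeleton_adj_of_isEdge ⟨s, hs, .inr (.inl ⟨rfl, rfl⟩)⟩

theorem skeleton_adj_left (hs : s ∈ S) : (skeleton S).Adj s (nw s) :=
  skeleton_adj_of_isEdge ⟨s, hs, .inr (.inr (.inl ⟨rfl, rfl⟩))⟩

theorem skeleton_adj_right (hs : s ∈ S) : (skeleton S).Adj (se s) (ne s) :=
  skeleton_adj_of_isEdge ⟨s, hs, .inr (.inr (.inr ⟨rfl, rfl⟩))⟩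

theorem skeleton_adj_induction {motive : ℤ × ℤ → ℤ × ℤ → Prop}
    (symm : ∀ v w, motive v w → motive w v)
    (bottom : ∀ s ∈ S, motive s (se s)) (top : ∀ s ∈ S, motive (nw s) (ne s))
    (left : ∀ s ∈ S, motive s (nw s)) (right : ∀ s ∈ S, motive (se s) (ne s))
    (h : (skeleton S).Adj v w) : motive v w := by
  have of_isEdge : ∀ {v w}, IsEdge S v w → motive v w := by
    rintro v w ⟨s, hs, ⟨rfl, rfl⟩ | ⟨rfl, rfl⟩ | ⟨rfl, rfl⟩ | ⟨rfl, rfl⟩⟩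
    exacts [bottom _ hs, top _ hs, left _ hs, right _ hs]
  exact ((SimpleGraph.fromRel_adj _ _ _).1 h).2.elim of_isEdge fun h => symm _ _ (of_isEdge h)

theorem mem_vertices_of_adj (h : (skeleton S).Adj v w) : v ∈ vertices S ∧ w ∈ vertices S :=
  skeleton_adj_induction (motive := fun v w => v ∈ vertices S ∧ w ∈ vertices S)
    (fun _ _ => And.symm)
    (fun _ hs => ⟨self_mem_vertices hs, se_mem_vertices hs⟩)
    (fun _ hs => ⟨nw_mem_vertices hs, ne_mem_vertices hs⟩)
    (fun _ hs => ⟨self_mem_vertices hs, nw_mem_vertices hs⟩)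
    (fun _ hs => ⟨se_mem_vertices hs, ne_mem_vertices hs⟩) h

theorem exists_common_edge (ht : t ∈ S)
    (h : (s.1 - t.1).natAbs + (s.2 - t.2).natAbs = 1) :
    ∃ v w, (skeleton S).Adj v w ∧ IsCorner s v ∧ IsCorner s w ∧ IsCorner t v ∧ IsCorner t w := by
  obtain ⟨m, n⟩ := s
  obtain ⟨k, l⟩ := t
  have : (k = m + 1 ∧ l = n) ∨ (k = m - 1 ∧ l = n) ∨ (k = m ∧ l = n + 1) ∨ (k = m ∧ l = n - 1) := by
    dsimp only at h
    omega
  rcases this with ⟨rfl, rfl⟩ | ⟨rfl, rfl⟩ | ⟨rfl, rfl⟩ | ⟨rfl, rfl⟩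
  · exact ⟨_, _, skeleton_adj_left ht, by simp [IsCorner, se, nw, ne]⟩
  · exact ⟨_, _, skeleton_adj_right ht, by simp [IsCorner, se, nw, ne]⟩
  · exact ⟨_, _, skeleton_adj_bottom ht, by simp [IsCorner, se, nw, ne]⟩
  · exact ⟨_, _, skeleton_adj_top ht, by simp [IsCorner, se, nw, ne]⟩

end Lattice

section Potential

variable {V A : Type*} {G : SimpleGraph V} [AddCommGroup A] {α : V → V → A} {v w x : V}

/-- The integral of the `1`-form `α`, given by its values on the oriented edges, along a walk. -/
def walkSum (α : V → V → A) (p : G.Walk v w) : A := (p.darts.map fun d => α d.fst d.snd).sum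

theorem walkSum_append (p : G.Walk v w) (q : G.Walk w x) :
    walkSum α (p.append q) = walkSum α p + walkSum α q := by
  simp [walkSum]

theorem walkSum_concat (p : G.Walk v w) (h : G.Adj w x) :
    walkSum α (p.concat h) = walkSum α p + α w x := by
  simp [walkSum]

theorem walkSum_copy {v' w' : V} (p : G.Walk v w) (hv : v = v') (hw : w = w') :
    walkSum α (p.copy hv hw) = walkSum α p :=
  congrArg (fun l => (l.map fun d => α d.fst d.snd).sum) (p.darts_copy hv hw)

theorem walkSum_sub (f : V → A) (p : G.Walk v w) :
    walkSum (fun x y => f y - f x) p = f w - f v := by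
  induction p with
  | nil => simp [walkSum]
  | cons h p ih =>
    simp only [walkSum] at ih
    simp [walkSum, ih]

theorem continuous_walkSum [TopologicalSpace A] [ContinuousAdd A] {T : Type*} [TopologicalSpace T]
    {α : T → V → V → A} (hα : ∀ v w, Continuous fun t => α t v w) (p : G.Walk v w) :
    Continuous fun t => walkSum (α t) p :=
  continuous_list_sum _ fun d _ => hα d.fst d.snd

variable (G) in
/-- A base point of the connected component of `v`, the same for all vertices of the component. -/
noncomputable def root (v : V) : V := (G.connectedComponentMk v).out

theorem root_eq_of_adj (h : G.Adj v w) : root G v = root G w :=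
  congrArg Quot.out (SimpleGraph.ConnectedComponent.sound h.reachable)

/-- A chosen walk to `v` from the base point of its component. -/
noncomputable def rootWalk (v : V) : G.Walk (root G v) v :=
  Classical.choice (SimpleGraph.ConnectedComponent.exact (Quot.out_eq _))

variable (G) in
/-- The primitive of the `1`-form `α` that agrees with `c` at the base point of each component. -/
noncomputable def potential (c : V → A) (α : V → V → A) (v : V) : A :=
  c (root G v) + walkSum α (rootWalk (G := G) v)

theorem potential_sub (c : V → A) : potential G c (fun v w => c w - c v) = c := by
  funext v
  rw [potential, walkSum_sub, add_sub_cancel]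

theorem potential_sub_potential (hα : ∀ v w (p q : G.Walk v w), walkSum α p = walkSum α q)
    (c : V → A) (h : G.Adj v w) : potential G c α w - potential G c α v = α v w := by
  have hwalk : walkSum α (rootWalk w) = walkSum α (rootWalk v) + α v w :=
    (hα _ _ _ (((rootWalk v).concat h).copy (root_eq_of_adj h) rfl)).trans <| by
      rw [walkSum_copy, walkSum_concat]
  rw [potential, potential, hwalk, congrArg c (root_eq_of_adj h)]
  abel

theorem continuous_potential [TopologicalSpace A] [ContinuousAdd A] {T : Type*}
    [TopologicalSpace T] {α : T → V → V → A} (hα : ∀ v w, Continuous fun t => α t v w)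
    (c : V → A) (v : V) : Continuous fun t => potential G c (α t) v :=
  continuous_const.add (continuous_walkSum hα _)

end Potential

section ClosedForm

variable {S : Set (ℤ × ℤ)} {A : Type*} [AddCommGroup A] {α : ℤ × ℤ → ℤ × ℤ → A} {v w : ℤ × ℤ}

/-- A closed `1`-form on the complex of the squares `S`: its integral around each square is `0`. -/
structure IsClosedForm (S : Set (ℤ × ℤ)) (α : ℤ × ℤ → ℤ × ℤ → A) : Prop where
  swap : ∀ v w, α w v = -α v w
  square : ∀ s ∈ S, α s (se s) + α (se s) (ne s) = α s (nw s) + α (nw s) (ne s)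

theorem EdgeHomotopic.walkSum_eq {p q : (skeleton S).Walk v w} (h : EdgeHomotopic S p q)
    (hα : IsClosedForm S α) : walkSum α p = walkSum α q := by
  induction h with
  | refl p => rfl
  | symm _ ih => exact ih.symm
  | trans _ _ ih₁ ih₂ => exact ih₁.trans ih₂
  | append _ _ ih₁ ih₂ => rw [walkSum_append, walkSum_append, ih₁, ih₂]
  | @backtrack v w => simp [walkSum, hα.swap v w]
  | square hs => simpa [walkSum] using hα.square _ hs

theorem IsClosedForm.walkSum_eq (hα : IsClosedForm S α)
    (hS : ∀ (v : ℤ × ℤ) (p : (skeleton S).Walk v v), EdgeHomotopic S p .nil)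
    (p q : (skeleton S).Walk v w) : walkSum α p = walkSum α q := by
  have hp := (hS v (p.append q.reverse)).walkSum_eq hα
  have hq := (hS v (q.append q.reverse)).walkSum_eq hα
  rw [walkSum_append] at hp hq
  exact add_right_cancel (hp.trans hq.symm)

end ClosedForm

section Rings

variable {P : Rings} {v w : ℤ × ℤ}

theorem exists_norm_eq_one_and_eq_mul {𝕜 : Type*} [RCLike 𝕜] {x y : 𝕜} (h : ‖x‖ = ‖y‖) :
    ∃ u : 𝕜, ‖u‖ = 1 ∧ x = u * y := by
  obtain ⟨a, ha, hax⟩ := RCLike.exists_norm_mul_eq_self x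
  obtain ⟨b, hb, hby⟩ := RCLike.exists_norm_eq_mul_self y
  exact ⟨a * b, by rw [norm_mul, ha, hb, one_mul], by rw [mul_assoc, ← hby, ← h, hax]⟩

theorem Rings.circlesOrthogonal_iff {A B : ℝ} (hA : 0 ≤ A) (hB : 0 ≤ B) :
    P.CirclesOrthogonal v w (Metric.sphere (P.center v) A) (Metric.sphere (P.center w) B) ↔
      dist (P.center v) (P.center w) ^ 2 = A ^ 2 + B ^ 2 := by
  constructor
  · rintro ⟨p, ⟨hA, hB⟩, hp⟩
    rw [mem_sphere_iff_norm] at hA hB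
    rw [← hA, ← hB, dist_eq_norm, ← norm_neg, neg_sub, ← sub_sub_sub_cancel_left _ _ p,
      norm_sub_sq_real, hp]
    ring
  · intro h
    have hnorm : ‖P.center w - P.center v‖ = ‖(A + B * I : ℂ)‖ := by
      rw [← sq_eq_sq₀ (norm_nonneg _) (norm_nonneg _), ← dist_eq_norm, dist_comm, h,
        Complex.sq_norm, normSq_add_mul_I]
    obtain ⟨u, hu, hw⟩ := exists_norm_eq_one_and_eq_mul hnorm
    have hpv : P.center v + u * A - P.center v = u * A := by ring
    have hpw : P.center v + u * A - P.center w = -(u * (B * I)) := by linear_combination -hw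
    refine ⟨P.center v + u * A, ⟨?_, ?_⟩, ?_⟩
    · rw [mem_sphere_iff_norm, hpv, norm_mul, hu, norm_real, Real.norm_of_nonneg hA, one_mul]
    · rw [mem_sphere_iff_norm, hpw, norm_neg, norm_mul, norm_mul, hu, norm_I, norm_real,
        Real.norm_of_nonneg hB, one_mul, mul_one]
    · rw [hpv, hpw, Complex.inner]
      simp only [map_mul, neg_mul, conj_ofReal, ofReal_re, ofReal_im, mul_re, mul_im, neg_re,
        conj_re, conj_im, I_re, I_im]
      ring

theorem Rings.ringsOrthogonal_iff (hv : 0 ≤ P.R v) (hw : 0 ≤ P.R w) :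
    P.RingsOrthogonal v w ↔
      dist (P.center v) (P.center w) ^ 2 = P.R v ^ 2 + P.r w ^ 2 ∧
        dist (P.center v) (P.center w) ^ 2 = P.r v ^ 2 + P.R w ^ 2 := by
  rw [← sq_abs (P.r v), ← sq_abs (P.r w), ← circlesOrthogonal_iff hv (abs_nonneg _),
    ← circlesOrthogonal_iff (abs_nonneg _) hw]
  rfl

theorem Rings.CirclesOrthogonal.symm {K L : Set ℂ} (h : P.CirclesOrthogonal v w K L) :
    P.CirclesOrthogonal w v L K := by
  obtain ⟨p, hp, hpp⟩ := h
  exact ⟨p, hp.symm, by rw [real_inner_comm, hpp]⟩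

theorem Rings.RingsOrthogonal.symm (h : P.RingsOrthogonal v w) : P.RingsOrthogonal w v :=
  ⟨h.2.symm, h.1.symm⟩

theorem Rings.RingsOrthogonal.area_eq (h : P.RingsOrthogonal v w) (hv : 0 ≤ P.R v)
    (hw : 0 ≤ P.R w) : P.area v = P.area w := by
  obtain ⟨h₁, h₂⟩ := (ringsOrthogonal_iff hv hw).1 h
  simp only [area]
  linear_combination Real.pi * (h₂ - h₁)

theorem Rings.RingsOrthogonal.center_ne (h : P.RingsOrthogonal v w) (hv : 0 < P.R v)
    (hw : 0 ≤ P.R w) : P.center v ≠ P.center w := by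
  have hdist := ((ringsOrthogonal_iff hv.le hw).1 h).1
  intro heq
  rw [heq, dist_self] at hdist
  nlinarith [sq_nonneg (P.r w), pow_pos hv 2]

theorem Rings.ringsOrthogonal_of_area_eq (hv : 0 ≤ P.R v) (hw : 0 ≤ P.R w)
    (harea : P.area v = P.area w)
    (h : dist (P.center v) (P.center w) ^ 2 = P.R v ^ 2 + P.r w ^ 2) : P.RingsOrthogonal v w := by
  refine (ringsOrthogonal_iff hv hw).2 ⟨h, ?_⟩
  have := mul_right_cancel₀ Real.pi_ne_zero harea
  linarith

end Rings

section Frame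

variable {S : Set (ℤ × ℤ)} {P : Rings} {α : ℤ × ℤ → ℤ × ℤ → ℂ} {r R : ℤ × ℤ → ℝ} {s : ℤ × ℤ}
  {c q u : ℂ} {x y : ℝ}

/-- The vector from the center of the ring at `v` to the center of the ring at `w`. -/
def Rings.edge (P : Rings) (v w : ℤ × ℤ) : ℂ := P.center w - P.center v

theorem Rings.dist_center (P : Rings) (v w : ℤ × ℤ) :
    dist (P.center v) (P.center w) = ‖P.edge v w‖ :=
  dist_eq_norm' _ _

/-- The `1`-form `α` takes on the sides of the square `s` the values it has for rings with radii `r`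
and `R` whose centers lie on two perpendicular lines through a common point, in the directions `u`
(centers of the outer circles) and `i u` (centers of the inner circles). -/
structure IsFrame (α : ℤ × ℤ → ℤ × ℤ → ℂ) (r R : ℤ × ℤ → ℝ) (s : ℤ × ℤ) (u : ℂ) : Prop where
  norm_eq_one : ‖u‖ = 1
  bottom : α s (se s) = u * (R (se s) + r s * I)
  top : α (nw s) (ne s) = u * (R (nw s) + r (ne s) * I)
  left : α s (nw s) = u * (-R (nw s) + r s * I)
  right : α (se s) (ne s) = u * (-R (se s) + r (ne s) * I)

theorem IsFrame.closed (h : IsFrame α r R s u) :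
    α s (se s) + α (se s) (ne s) = α s (nw s) + α (nw s) (ne s) := by
  rw [h.bottom, h.right, h.left, h.top]
  ring

theorem IsFrame.dist_sq (h : IsFrame P.edge r R s u) :
    dist (P.center (se s)) (P.center s) ^ 2 = R (se s) ^ 2 + r s ^ 2 ∧
    dist (P.center (nw s)) (P.center (ne s)) ^ 2 = R (nw s) ^ 2 + r (ne s) ^ 2 ∧
    dist (P.center (nw s)) (P.center s) ^ 2 = R (nw s) ^ 2 + r s ^ 2 ∧
    dist (P.center (se s)) (P.center (ne s)) ^ 2 = R (se s) ^ 2 + r (ne s) ^ 2 := by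
  have norm_sq (a b : ℝ) : ‖u * (a + b * I)‖ ^ 2 = a ^ 2 + b ^ 2 := by
    rw [norm_mul, h.norm_eq_one, one_mul, Complex.sq_norm, normSq_add_mul_I]
  refine ⟨?_, ?_, ?_, ?_⟩
  · rw [dist_comm, Rings.dist_center, h.bottom, norm_sq]
  · rw [Rings.dist_center, h.top, norm_sq]
  · rw [dist_comm, Rings.dist_center, h.left, ← ofReal_neg, norm_sq, neg_sq]
  · rw [Rings.dist_center, h.right, ← ofReal_neg, norm_sq, neg_sq]

theorem isFrame_edge_iff : IsFrame P.edge r R s u ↔ ‖u‖ = 1 ∧ ∃ q,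
    P.center s = q + u * ((-r s : ℝ) * I) ∧ P.center (se s) = q + u * R (se s) ∧
      P.center (ne s) = q + u * (r (ne s) * I) ∧ P.center (nw s) = q + u * (-R (nw s) : ℝ) := by
  simp only [ofReal_neg]
  constructor
  · intro h
    have hbottom := sub_eq_iff_eq_add.1 h.bottom
    refine ⟨h.norm_eq_one, P.center s + u * (r s * I), ?_, ?_, ?_, ?_⟩
    · ring
    · linear_combination hbottom
    · linear_combination hbottom + sub_eq_iff_eq_add.1 h.right
    · linear_combination sub_eq_iff_eq_add.1 h.left
  · rintro ⟨hu, q, hsw, hse, hne, hnw⟩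
    refine ⟨hu, ?_, ?_, ?_, ?_⟩ <;> simp only [Rings.edge, hsw, hse, hne, hnw] <;> ring

theorem orient_swap (a b c : ℂ) : orient a c b = -orient a b c := by
  simp only [orient]
  ring

theorem orient_add_mul_ofReal (hu : ‖u‖ = 1) (q z : ℂ) (x : ℝ) :
    orient (q + u * z) q (q + u * x) = x * z.im := by
  have hu' : u.re * u.re + u.im * u.im = 1 := by
    rw [← normSq_apply, normSq_eq_norm_sq, hu, one_pow]
  simp only [orient, sub_re, sub_im, add_re, add_im, mul_re, mul_im, ofReal_re, ofReal_im]
  linear_combination x * z.im * hu'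

theorem IsFrame.exists_fitsAt (h : IsFrame P.edge P.r P.R s u) (hse : 0 < P.R (se s))
    (hnw : 0 < P.R (nw s)) : ∃ q, FitsAt P s q := by
  obtain ⟨-, q, hcsw, hcse, hcne, hcnw⟩ := isFrame_edge_iff.1 h
  have hdist (z : ℂ) : dist q (q + u * z) = ‖z‖ := by
    rw [dist_self_add_right, norm_mul, h.norm_eq_one, one_mul]
  have hsign {x y : ℝ} (hx : 0 < x) : SignType.sign (x * y) = SignType.sign y := by
    rw [sign_mul, sign_pos hx, one_mul]
  have hnorm (x : ℝ) : ‖(x * I : ℂ)‖ = |x| := by simp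
  have him (x : ℝ) : (x * I).im = x := by simp
  refine ⟨q, ?_, ?_, ?_, ?_, ?_, ?_, ?_, ?_, ?_⟩
  · rw [Rings.inner, Metric.mem_sphere, hcsw, hdist, hnorm, abs_neg]
  · rw [Rings.inner, Metric.mem_sphere, hcne, hdist, hnorm]
  · rw [Rings.outer, Metric.mem_sphere, hcse, hdist, norm_real, Real.norm_of_nonneg hse.le]
  · rw [Rings.outer, Metric.mem_sphere, hcnw, hdist, norm_real, norm_neg,
      Real.norm_of_nonneg hnw.le]
  · rw [orient_swap, hcsw, hcse, orient_add_mul_ofReal h.norm_eq_one, him, mul_neg, neg_neg,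
      hsign hse]
  · rw [hcsw, hcnw, orient_add_mul_ofReal h.norm_eq_one, him, neg_mul_neg, hsign hnw]
  · rw [orient_swap, hcne, hcnw, orient_add_mul_ofReal h.norm_eq_one, him, neg_mul, neg_neg,
      hsign hnw]
  · rw [hcne, hcse, orient_add_mul_ofReal h.norm_eq_one, him, hsign hse]
  · rw [hcse, hcnw, dist_add_left, dist_eq_norm, ← mul_sub, norm_mul, h.norm_eq_one, one_mul,
      ← ofReal_sub, norm_real, sub_neg_eq_add, Real.norm_of_nonneg (add_pos hse hnw).le]

/-- Pythagoras gives a right angle at `q`, so only the two points `q ± r i u` are possible, and the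
orientation decides between them. -/
theorem eq_add_mul_I_of_orient (hx : 0 < x) (hu : ‖u‖ = 1) (hq : dist q c = |y|)
    (hc : dist (q + u * x) c ^ 2 = x ^ 2 + y ^ 2)
    (ho : SignType.sign (orient c q (q + u * x)) = SignType.sign y) : c = q + u * (y * I) := by
  obtain ⟨z, rfl⟩ : ∃ z, c = q + u * z :=
    ⟨(c - q) / u, by rw [mul_div_cancel₀ _ (norm_ne_zero_iff.1 (hu ▸ one_ne_zero)), add_sub_cancel]⟩
  rw [orient_add_mul_ofReal hu, sign_mul, sign_pos hx, one_mul] at ho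
  rw [dist_self_add_right, norm_mul, hu, one_mul, ← abs_norm, ← sq_eq_sq_iff_abs_eq_abs,
    Complex.sq_norm, normSq_apply] at hq
  rw [dist_add_left, dist_eq_norm, ← mul_sub, norm_mul, hu, one_mul, Complex.sq_norm,
    normSq_apply, sub_re, sub_im, ofReal_re, ofReal_im] at hc
  have hre : z.re = 0 := (mul_eq_zero.1 (by linarith : x * z.re = 0)).resolve_left hx.ne'
  have him : |z.im| = |y| := (sq_eq_sq_iff_abs_eq_abs _ _).1 (by rw [← hq, hre]; ring)
  congr
  apply Complex.ext
  · simp [hre]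
  · rw [← sign_mul_abs z.im, ho, him, sign_mul_abs]
    simp

theorem FitsAt.exists_axis (h : FitsAt P s q) (hse : 0 < P.R (se s)) :
    ∃ u : ℂ, ‖u‖ = 1 ∧ P.center (se s) = q + u * P.R (se s) ∧
      P.center (nw s) = q + u * (-P.R (nw s) : ℝ) := by
  have hdse : ‖P.center (se s) - q‖ = P.R (se s) := by
    rw [← dist_eq_norm, dist_comm, Metric.mem_sphere.1 h.mem_outer_se]
  have hdnw : ‖q - P.center (nw s)‖ = P.R (nw s) := by
    rw [← dist_eq_norm, Metric.mem_sphere.1 h.mem_outer_nw]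
  have hray : SameRay ℝ (P.center (se s) - q) (q - P.center (nw s)) := by
    rw [sameRay_iff_norm_add, sub_add_sub_cancel, hdse, hdnw, ← dist_eq_norm, h.outer_touch]
  have hsmul := hray.norm_smul_eq
  rw [hdse, hdnw, real_smul, real_smul] at hsmul
  have hne : (P.R (se s) : ℂ) ≠ 0 := ofReal_ne_zero.2 hse.ne'
  refine ⟨(P.center (se s) - q) / P.R (se s), ?_, ?_, ?_⟩
  · rw [norm_div, hdse, norm_real, Real.norm_of_nonneg hse.le, div_self hse.ne']
  · rw [div_mul_cancel₀ _ hne, add_sub_cancel]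
  · push_cast
    field_simp
    linear_combination -hsmul

theorem IsOrthogonalRingPattern.exists_isFrame (hP : IsOrthogonalRingPattern S P) (hs : s ∈ S) :
    ∃ u, IsFrame P.edge P.r P.R s u := by
  obtain ⟨q, hq⟩ := hP.fits s hs
  have hR {v} (hv : v ∈ vertices S) : 0 ≤ P.R v := (hP.outer_pos v hv).le
  have hse := hP.outer_pos _ (se_mem_vertices hs)
  obtain ⟨u, hu, hcse, hcnw⟩ := hq.exists_axis hse
  have hcsw : P.center s = q + u * ((-P.r s : ℝ) * I) := by
    have hdist := ((Rings.ringsOrthogonal_iff (hR (self_mem_vertices hs)) hse.le).1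
      (hP.orthogonal _ _ (skeleton_adj_bottom hs))).2
    refine eq_add_mul_I_of_orient hse hu ?_ ?_ ?_
    · rw [abs_neg, Metric.mem_sphere.1 hq.mem_inner_sw]
    · rw [← hcse, dist_comm, hdist, neg_sq, add_comm]
    · rw [← hcse, orient_swap, Left.sign_neg, hq.orient_sw_se, Left.sign_neg]
  have hcne : P.center (ne s) = q + u * (P.r (ne s) * I) := by
    have hdist := ((Rings.ringsOrthogonal_iff hse.le (hR (ne_mem_vertices hs))).1
      (hP.orthogonal _ _ (skeleton_adj_right hs))).1
    refine eq_add_mul_I_of_orient hse hu (Metric.mem_sphere.1 hq.mem_inner_ne) ?_ ?_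
    · rw [← hcse, hdist]
    · rw [← hcse, hq.orient_ne_se]
  exact ⟨u, isFrame_edge_iff.2 ⟨hu, q, hcsw, hcse, hcne, hcnw⟩⟩

theorem isOrthogonalRingPattern_iff_exists_isFrame :
    IsOrthogonalRingPattern S P ↔ (∀ v ∈ vertices S, 0 < P.R v) ∧
      (∀ v w, (skeleton S).Adj v w → P.area v = P.area w) ∧
      ∀ s ∈ S, ∃ u, IsFrame P.edge P.r P.R s u := by
  refine ⟨fun h => ⟨h.outer_pos, fun v w hvw => ?_, fun s hs => h.exists_isFrame hs⟩, ?_⟩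
  · obtain ⟨hv, hw⟩ := mem_vertices_of_adj hvw
    exact (h.orthogonal v w hvw).area_eq (h.outer_pos v hv).le (h.outer_pos w hw).le
  · rintro ⟨hpos, harea, hframe⟩
    have horth {v w} (hvw : (skeleton S).Adj v w) (hdist :
        dist (P.center v) (P.center w) ^ 2 = P.R v ^ 2 + P.r w ^ 2) : P.RingsOrthogonal v w :=
      Rings.ringsOrthogonal_of_area_eq (hpos v (mem_vertices_of_adj hvw).1).le
        (hpos w (mem_vertices_of_adj hvw).2).le (harea v w hvw) hdist
    refine ⟨hpos, fun v w hvw => ?_, fun s hs => ?_⟩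
    · refine skeleton_adj_induction (motive := P.RingsOrthogonal) (fun _ _ h => h.symm) ?_ ?_ ?_ ?_
        hvw <;> intro s hs <;> obtain ⟨u, h⟩ := hframe s hs
      · exact (horth (skeleton_adj_bottom hs).symm h.dist_sq.1).symm
      · exact horth (skeleton_adj_top hs) h.dist_sq.2.1
      · exact (horth (skeleton_adj_left hs).symm h.dist_sq.2.2.1).symm
      · exact horth (skeleton_adj_right hs) h.dist_sq.2.2.2
    · obtain ⟨u, h⟩ := hframe s hs
      exact h.exists_fitsAt (hpos _ (se_mem_vertices hs)) (hpos _ (nw_mem_vertices hs))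

end Frame

section Uniqueness

variable {S : Set (ℤ × ℤ)} {Q Q' : Rings} {s : ℤ × ℤ} {u u' : ℂ}

theorem IsFrame.exists_isometry (h : IsFrame Q.edge Q.r Q.R s u)
    (h' : IsFrame Q'.edge Q'.r Q'.R s u')
    (hr : ∀ v, IsCorner s v → Q'.r v = Q.r v) (hR : ∀ v, IsCorner s v → Q'.R v = Q.R v) :
    ∃ a b : ℂ, ‖a‖ = 1 ∧ ∀ v, IsCorner s v → Q'.center v = a * Q.center v + b := by
  have hu : u ≠ 0 := norm_ne_zero_iff.1 (h.norm_eq_one ▸ one_ne_zero)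
  have hbottom : Q'.edge s (se s) = u' / u * Q.edge s (se s) := by
    rw [h.bottom, h'.bottom, hr s (.inl rfl), hR (se s) (.inr (.inl rfl))]
    field_simp
  have hright : Q'.edge (se s) (ne s) = u' / u * Q.edge (se s) (ne s) := by
    rw [h.right, h'.right, hr (ne s) (.inr (.inr (.inl rfl))), hR (se s) (.inr (.inl rfl))]
    field_simp
  have hleft : Q'.edge s (nw s) = u' / u * Q.edge s (nw s) := by
    rw [h.left, h'.left, hr s (.inl rfl), hR (nw s) (.inr (.inr (.inr rfl)))]
    field_simp
  simp only [Rings.edge] at hbottom hright hleft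
  refine ⟨u' / u, Q'.center s - u' / u * Q.center s,
    by rw [norm_div, h.norm_eq_one, h'.norm_eq_one, div_one], ?_⟩
  rintro v (rfl | rfl | rfl | rfl)
  · ring
  · linear_combination hbottom
  · linear_combination hbottom + hright
  · linear_combination hleft

theorem IsOrthogonalRingPattern.exists_isometry (hQ : IsOrthogonalRingPattern S Q)
    (hQ' : IsOrthogonalRingPattern S Q') (hS : SideConnected S)
    (hr : ∀ v ∈ vertices S, Q'.r v = Q.r v) (hR : ∀ v ∈ vertices S, Q'.R v = Q.R v) :
    ∃ a b : ℂ, ‖a‖ = 1 ∧ ∀ v ∈ vertices S, Q'.center v = a * Q.center v + b := by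
  have hsquare {s} (hs : s ∈ S) :
      ∃ a b : ℂ, ‖a‖ = 1 ∧ ∀ v, IsCorner s v → Q'.center v = a * Q.center v + b := by
    obtain ⟨u, h⟩ := hQ.exists_isFrame hs
    obtain ⟨u', h'⟩ := hQ'.exists_isFrame hs
    exact h.exists_isometry h' (fun v hv => hr v ⟨s, hs, hv⟩) fun v hv => hR v ⟨s, hs, hv⟩
  rcases S.eq_empty_or_nonempty with rfl | ⟨s, hs⟩
  · exact ⟨1, 0, norm_one, fun v ⟨_, h, _⟩ => h.elim⟩
  obtain ⟨a, b, ha, hab⟩ := hsquare hs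
  suffices ∀ t ∈ S, ∀ v, IsCorner t v → Q'.center v = a * Q.center v + b from
    ⟨a, b, ha, fun v ⟨t, ht, hv⟩ => this t ht v hv⟩
  intro t ht
  have hst := hS s hs t ht
  clear ht
  induction hst with
  | refl => exact hab
  | @tail x y _ hxy ih =>
    obtain ⟨hy, hxy⟩ := hxy
    obtain ⟨v, w, hvw, hxv, hxw, hyv, hyw⟩ := exists_common_edge hy hxy
    obtain ⟨a', b', -, hab'⟩ := hsquare hy
    obtain ⟨hv, hw⟩ := mem_vertices_of_adj hvw
    have hne : Q.center v ≠ Q.center w :=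
      (hQ.orthogonal v w hvw).center_ne (hQ.outer_pos v hv) (hQ.outer_pos w hw).le
    have hv' := (ih v hxv).symm.trans (hab' v hyv)
    have hw' := (ih w hxw).symm.trans (hab' w hyw)
    obtain rfl : a = a' :=
      mul_right_cancel₀ (sub_ne_zero.2 hne) (by linear_combination hv' - hw')
    obtain rfl : b = b' := add_left_cancel hv'
    exact hab'

end Uniqueness

section Shift

variable {S : Set (ℤ × ℤ)} {P : Rings} {ℓ : ℝ} {ρ : ℤ × ℤ → ℝ} {s : ℤ × ℤ} {u : ℂ}

/-- `cosh t + i sinh t`. -/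
noncomputable def coshSinh (t : ℝ) : ℂ := Complex.cosh t + Complex.sinh t * I

theorem coshSinh_ne_zero (t : ℝ) : coshSinh t ≠ 0 := fun h =>
  (Real.cosh_pos t).ne' <| by
    simpa [coshSinh, ← ofReal_cosh, ← ofReal_sinh, -ofReal_cosh, -ofReal_sinh] using congrArg re h

theorem coshSinh_mul_conj (x y : ℝ) :
    coshSinh x * conj (coshSinh y) = Complex.cosh ↑(x + y) + Complex.sinh ↑(x - y) * I := by
  simp only [coshSinh, map_add, map_mul, ← cosh_conj, ← sinh_conj, conj_ofReal, conj_I, ofReal_add,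
    ofReal_sub, Complex.cosh_add, Complex.sinh_sub]
  linear_combination -Complex.sinh x * Complex.sinh y * I_sq

/-- The factor by which a horizontal edge vector changes when the `ρ`-radii at its endpoints, of
mean `m`, are shifted by `δ`. -/
noncomputable def shiftFactor (m δ : ℝ) : ℂ := coshSinh (m + δ) / coshSinh m

theorem shiftFactor_zero (m : ℝ) : shiftFactor m 0 = 1 := by
  rw [shiftFactor, add_zero, div_self (coshSinh_ne_zero m)]

theorem continuous_shiftFactor (m : ℝ) : Continuous (shiftFactor m) := by
  unfold shiftFactor coshSinh
  fun_prop

/-- With `a = x + y` and `b = x - y`, the edge vector factors as `coshSinh x * conj (coshSinh y)`,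
and the shift by `δ` only changes `x`. -/
theorem cosh_add_sinh_mul_I_mul_shiftFactor (a b δ : ℝ) :
    (Complex.cosh a + Complex.sinh b * I) * shiftFactor ((a + b) / 2) δ =
      Complex.cosh ↑(a + δ) + Complex.sinh ↑(b + δ) * I := by
  obtain ⟨x, y, rfl, rfl⟩ : ∃ x y, a = x + y ∧ b = x - y :=
    ⟨(a + b) / 2, (a - b) / 2, by ring, by ring⟩
  rw [show (x + y + (x - y)) / 2 = x by ring, show x + y + δ = x + δ + y by ring,
    show x - y + δ = x + δ - y by ring, ← coshSinh_mul_conj, ← coshSinh_mul_conj, shiftFactor,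
    mul_comm, ← mul_assoc, div_mul_cancel₀ _ (coshSinh_ne_zero x)]

theorem neg_cosh_add_sinh_mul_I_mul_conj_shiftFactor (a b δ : ℝ) :
    (-Complex.cosh a + Complex.sinh b * I) * conj (shiftFactor ((a + b) / 2) δ) =
      -Complex.cosh ↑(a + δ) + Complex.sinh ↑(b + δ) * I := by
  have h := congrArg conj (cosh_add_sinh_mul_I_mul_shiftFactor a b δ)
  simp only [map_add, map_mul, ← cosh_conj, ← sinh_conj, conj_ofReal, conj_I] at h
  linear_combination -h

/-- The edge vectors of the pattern with `ρ`-radii shifted by `δ`: those of `P`, each rescaled by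
the factor that only depends on the mean `ρ`-radius of its endpoints. -/
noncomputable def shiftedEdge (P : Rings) (ρ : ℤ × ℤ → ℝ) (δ : ℝ) (v w : ℤ × ℤ) : ℂ :=
  P.edge v w * if v.2 = w.2 then shiftFactor ((ρ v + ρ w) / 2) δ
    else conj (shiftFactor ((ρ v + ρ w) / 2) δ)

theorem shiftedEdge_swap (P : Rings) (ρ : ℤ × ℤ → ℝ) (δ : ℝ) (v w : ℤ × ℤ) :
    shiftedEdge P ρ δ w v = -shiftedEdge P ρ δ v w := by
  simp only [shiftedEdge, Rings.edge, eq_comm (a := w.2), add_comm (ρ w)]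
  ring

theorem shiftedEdge_zero (P : Rings) (ρ : ℤ × ℤ → ℝ) : shiftedEdge P ρ 0 = P.edge := by
  funext v w
  simp [shiftedEdge, shiftFactor_zero]

theorem continuous_shiftedEdge (P : Rings) (ρ : ℤ × ℤ → ℝ) (v w : ℤ × ℤ) :
    Continuous fun δ => shiftedEdge P ρ δ v w := by
  have := continuous_shiftFactor ((ρ v + ρ w) / 2)
  unfold shiftedEdge
  split_ifs <;> fun_prop

theorem IsFrame.shift (h : IsFrame P.edge P.r P.R s u) (hρ : HasRhoRadii S P ℓ ρ) (hs : s ∈ S)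
    (δ : ℝ) : IsFrame (shiftedEdge P ρ δ) (fun v => ℓ * Real.sinh (ρ v + δ))
      (fun v => ℓ * Real.cosh (ρ v + δ)) s u := by
  have hsw := (hρ _ (self_mem_vertices hs)).1
  have hse := (hρ _ (se_mem_vertices hs)).2
  have hne := (hρ _ (ne_mem_vertices hs)).1
  have hnw := (hρ _ (nw_mem_vertices hs)).2
  refine ⟨h.norm_eq_one, ?_, ?_, ?_, ?_⟩
  · rw [shiftedEdge, if_pos (show s.2 = (se s).2 from rfl), h.bottom, hsw, hse, add_comm (ρ s)]
    simp only [ofReal_mul, ofReal_cosh, ofReal_sinh]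
    linear_combination u * ℓ * cosh_add_sinh_mul_I_mul_shiftFactor (ρ (se s)) (ρ s) δ
  · rw [shiftedEdge, if_pos (show (nw s).2 = (ne s).2 from rfl), h.top, hne, hnw]
    simp only [ofReal_mul, ofReal_cosh, ofReal_sinh]
    linear_combination u * ℓ * cosh_add_sinh_mul_I_mul_shiftFactor (ρ (nw s)) (ρ (ne s)) δ
  · rw [shiftedEdge, if_neg (by simp [nw]), h.left, hsw, hnw, add_comm (ρ s)]
    simp only [ofReal_mul, ofReal_cosh, ofReal_sinh]
    linear_combination u * ℓ * neg_cosh_add_sinh_mul_I_mul_conj_shiftFactor (ρ (nw s)) (ρ s) δ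
  · rw [shiftedEdge, if_neg (by simp [se, ne]), h.right, hne, hse]
    simp only [ofReal_mul, ofReal_cosh, ofReal_sinh]
    linear_combination u * ℓ * neg_cosh_add_sinh_mul_I_mul_conj_shiftFactor (ρ (se s)) (ρ (ne s)) δ

/-- The rings with `ρ`-radii shifted by `δ`; in each component of the complex the center of one
ring stays fixed. -/
noncomputable def shiftedRings (S : Set (ℤ × ℤ)) (P : Rings) (ℓ : ℝ) (ρ : ℤ × ℤ → ℝ) (δ : ℝ) :
    Rings where
  center := potential (skeleton S) P.center (shiftedEdge P ρ δ)
  r v := ℓ * Real.sinh (ρ v + δ)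
  R v := ℓ * Real.cosh (ρ v + δ)

theorem shiftedRings_center_zero : (shiftedRings S P ℓ ρ 0).center = P.center := by
  rw [shiftedRings, shiftedEdge_zero]
  exact potential_sub P.center

theorem continuous_shiftedRings_center (v : ℤ × ℤ) :
    Continuous fun δ => (shiftedRings S P ℓ ρ δ).center v :=
  continuous_potential (continuous_shiftedEdge P ρ) P.center v

theorem hasRhoRadii_shiftedRings (δ : ℝ) :
    HasRhoRadii S (shiftedRings S P ℓ ρ δ) ℓ fun v => ρ v + δ :=
  fun _ _ => ⟨rfl, rfl⟩

theorem HasRhoRadii.area_eq (hρ : HasRhoRadii S P ℓ ρ) {v : ℤ × ℤ} (hv : v ∈ vertices S) :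
    P.area v = ℓ ^ 2 * Real.pi := by
  rw [Rings.area, (hρ v hv).1, (hρ v hv).2, mul_pow, mul_pow, Real.cosh_sq]
  ring

theorem HasRhoRadii.outer_pos_iff (hρ : HasRhoRadii S P ℓ ρ) {v : ℤ × ℤ} (hv : v ∈ vertices S) :
    0 < P.R v ↔ 0 < ℓ := by
  rw [(hρ v hv).2, mul_pos_iff_of_pos_right (Real.cosh_pos _)]

theorem isClosedForm_shiftedEdge (hP : IsOrthogonalRingPattern S P) (hρ : HasRhoRadii S P ℓ ρ)
    (δ : ℝ) : IsClosedForm S (shiftedEdge P ρ δ) where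
  swap := shiftedEdge_swap P ρ δ
  square s hs := by
    obtain ⟨u, h⟩ := hP.exists_isFrame hs
    exact (h.shift hρ hs δ).closed

theorem isOrthogonalRingPattern_shiftedRings
    (hS : ∀ (v : ℤ × ℤ) (p : (skeleton S).Walk v v), EdgeHomotopic S p .nil)
    (hP : IsOrthogonalRingPattern S P) (hρ : HasRhoRadii S P ℓ ρ) (δ : ℝ) :
    IsOrthogonalRingPattern S (shiftedRings S P ℓ ρ δ) := by
  have hedge {v w} (h : (skeleton S).Adj v w) :
      (shiftedRings S P ℓ ρ δ).edge v w = shiftedEdge P ρ δ v w :=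
    potential_sub_potential
      (fun _ _ => (isClosedForm_shiftedEdge hP hρ δ).walkSum_eq hS) P.center h
  have hρ' := hasRhoRadii_shiftedRings (S := S) (P := P) (ℓ := ℓ) (ρ := ρ) δ
  refine isOrthogonalRingPattern_iff_exists_isFrame.2 ⟨fun v hv => ?_, fun v w hvw => ?_,
    fun s hs => ?_⟩
  · exact (hρ'.outer_pos_iff hv).2 ((hρ.outer_pos_iff hv).1 (hP.outer_pos v hv))
  · obtain ⟨hv, hw⟩ := mem_vertices_of_adj hvw
    rw [hρ'.area_eq hv, hρ'.area_eq hw]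
  · obtain ⟨u, h⟩ := hP.exists_isFrame hs
    obtain ⟨hu, hbottom, htop, hleft, hright⟩ := h.shift hρ hs δ
    exact ⟨u, hu, (hedge (skeleton_adj_bottom hs)).trans hbottom,
      (hedge (skeleton_adj_top hs)).trans htop, (hedge (skeleton_adj_left hs)).trans hleft,
      (hedge (skeleton_adj_right hs)).trans hright⟩

end Shift

end RingPattern

theorem corollary1_general (S : Set (ℤ × ℤ))
    (hS : ∀ (v : ℤ × ℤ) (p : (skeleton S).Walk v v), EdgeHomotopic S p .nil)
    (P : Rings) (hP : IsOrthogonalRingPattern S P)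
    (ℓ : ℝ) (ρ : ℤ × ℤ → ℝ) (hρ : HasRhoRadii S P ℓ ρ) :
    (∃ Q : ℝ → Rings,
      (∀ v ∈ vertices S, (Q 0).center v = P.center v) ∧
      (∀ v ∈ vertices S, Continuous fun δ => (Q δ).center v) ∧
      ∀ δ : ℝ, IsOrthogonalRingPattern S (Q δ) ∧
        HasRhoRadii S (Q δ) ℓ (fun v => ρ v + δ) ∧
        ∀ v ∈ vertices S,
          (Q δ).r v = ℓ * Real.sinh (ρ v + δ) ∧ (Q δ).R v = ℓ * Real.cosh (ρ v + δ) ∧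
            (Q δ).area v = ℓ ^ 2 * Real.pi) ∧
    (SideConnected S → ∀ δ : ℝ, ∀ Q Q' : Rings,
      IsOrthogonalRingPattern S Q → HasRhoRadii S Q ℓ (fun v => ρ v + δ) →
      IsOrthogonalRingPattern S Q' → HasRhoRadii S Q' ℓ (fun v => ρ v + δ) →
      ∃ a b : ℂ, ‖a‖ = 1 ∧ ∀ v ∈ vertices S, Q'.center v = a * Q.center v + b) := by
  refine ⟨⟨shiftedRings S P ℓ ρ, fun v _ => congrFun shiftedRings_center_zero v,
    fun v _ => continuous_shiftedRings_center v, fun δ => ?_⟩, fun hSC δ Q Q' hQ hQρ hQ' hQρ' => ?_⟩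
  · have hδ := hasRhoRadii_shiftedRings (S := S) (P := P) (ℓ := ℓ) (ρ := ρ) δ
    exact ⟨isOrthogonalRingPattern_shiftedRings hS hP hρ δ, hδ,
      fun v hv => ⟨(hδ v hv).1, (hδ v hv).2, hδ.area_eq hv⟩⟩
  · exact hQ.exists_isometry hQ' hSC (fun v hv => (hQρ' v hv).1.trans (hQρ v hv).1.symm)
      fun v hv => (hQρ' v hv).2.trans (hQρ v hv).2.symm

theorem corollary1 (S : Set (ℤ × ℤ)) (hS : SimplyConnectedComplex S)
    (P : Rings) (hP : IsOrthogonalRingPattern S P)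
    (harea : ∀ v ∈ vertices S, P.area v = Real.pi)
    (ρ : ℤ × ℤ → ℝ) (hρ : HasRhoRadii S P 1 ρ) :
    (∃ Q : ℝ → Rings,
      (∀ v ∈ vertices S, (Q 0).center v = P.center v) ∧
      (∀ v ∈ vertices S, Continuous fun δ => (Q δ).center v) ∧
      ∀ δ : ℝ, IsOrthogonalRingPattern S (Q δ) ∧
        HasRhoRadii S (Q δ) 1 (fun v => ρ v + δ) ∧
        ∀ v ∈ vertices S,
          (Q δ).r v = Real.sinh (ρ v + δ) ∧ (Q δ).R v = Real.cosh (ρ v + δ) ∧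
            (Q δ).area v = Real.pi) ∧
    (SideConnected S → ∀ δ : ℝ, ∀ Q Q' : Rings,
      IsOrthogonalRingPattern S Q → HasRhoRadii S Q 1 (fun v => ρ v + δ) →
      IsOrthogonalRingPattern S Q' → HasRhoRadii S Q' 1 (fun v => ρ v + δ) →
      ∃ a b : ℂ, ‖a‖ = 1 ∧ ∀ v ∈ vertices S, Q'.center v = a * Q.center v + b) := by
  simpa only [one_mul, one_pow] using corollary1_general S hS.loops P hP 1 ρ hρ
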